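/- Let $G$ be a finite group. Let $c=c(G)$ be its chief length, that is, the maximum number of terms in a maximal strictly increasing chain of normal subgroups of $G$ (both $\{1\}$ and $G$ are counted as terms, so $c=1$ for the trivial group). For $n\ge 1$ let $G\wr\mathcal{I}_n$ be the monoid of all pairs $(g;a)$ where $a$ is a partial injective map from $\{1,\dots,n\}$ to itself and $g=(g_1,\dots,g_n)$ has entries in $G\cup\{0\}$ (the group $G$ with a zero adjoined) with $g_i\neq 0$ if and only if $i\in\operatorname{dom}(a)$. Its multiplication is $$(g;a)(h;b)=(g_1h_{1a},\dots,g_nh_{na};ab),$$ where partial maps act on the right and $h_{ia}=0$ if $ia$ is undefined. Equivalently, $G\wr\mathcal{I}_n$ is the partial automorphism monoid of the free $G$-act of rank $n$. Let $\mathfrak{C}(G\wr\mathcal{I}_n)$ be the set of all congruences on $G\wr\mathcal{I}_n$. Then there are real constants $A,B>0$, depending only on $G$, such that for all $n\ge 1$ $$An^{c}\leq |\mathfrak{C}(G\wr\mathcal{I}_n)|\leq Bn^{2c-1}.$$ -/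

import Mathlib

/-- The monoid `G ≀ I_n`: pairs `(g; a)` with `g ∈ (G⁰)ⁿ`, where `G⁰` is `G` with a zero adjoined,
and `a` a partial injective map of `Fin n`, such that `g_i ≠ 0` exactly when `i ∈ dom a`.
It is the partial automorphism monoid of the free `G`-act of rank `n`. -/
@[ext]
structure PartialWreath (G : Type*) [Group G] (n : ℕ) where
  /-- the labels `g_1, …, g_n` in `G⁰` -/
  label : Fin n → WithZero G
  /-- the element `a` of the symmetric inverse monoid `I_n` -/
  map : Fin n ≃. Fin n
  label_ne_zero_iff : ∀ i, label i ≠ 0 ↔ (map i).isSome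

namespace PartialWreath

variable {G : Type*} [Group G] {n : ℕ}

/-- The `i`-th entry `h_{ia}` of `h_a`, read as `0` if `ia` is undefined. -/
def pull (h : Fin n → WithZero G) (a : Fin n ≃. Fin n) (i : Fin n) : WithZero G :=
  (a i).elim 0 h

/-- Multiplication `(g; a)(h; b) = (g_1 h_{1a}, …, g_n h_{na}; ab)`, with maps composed from left
to right. -/
instance : Mul (PartialWreath G n) where
  mul x y :=
    { label := fun i => x.label i * pull y.label x.map i
      map := x.map.trans y.map
      label_ne_zero_iff := by
        intro i
        have hx := x.label_ne_zero_iff i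
        cases hi : x.map i with
        | none => simp [pull, hi, PEquiv.trans]
        | some j =>
          have hy := y.label_ne_zero_iff j
          rw [hi] at hx
          simp_all [pull, PEquiv.trans] }

@[simp] theorem mul_label (x y : PartialWreath G n) (i : Fin n) :
    (x * y).label i = x.label i * pull y.label x.map i := rfl

@[simp] theorem mul_map (x y : PartialWreath G n) : (x * y).map = x.map.trans y.map := rfl

instance : One (PartialWreath G n) where
  one :=
    { label := fun _ => 1
      map := PEquiv.refl (Fin n)
      label_ne_zero_iff := by intro i; simp }

@[simp] theorem one_label (i : Fin n) : (1 : PartialWreath G n).label i = 1 := rfl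

@[simp] theorem one_map : (1 : PartialWreath G n).map = PEquiv.refl (Fin n) := rfl

instance : Monoid (PartialWreath G n) where
  mul_assoc x y z := by
    ext1
    · funext i
      cases hi : x.map i <;> simp [pull, hi, PEquiv.trans, mul_assoc]
    · exact PEquiv.trans_assoc _ _ _
  one_mul x := by
    ext1
    · funext i
      simp [pull]
    · exact PEquiv.refl_trans _
  mul_one x := by
    ext1
    · funext i
      have hx := x.label_ne_zero_iff i
      cases hi : x.map i <;> simp_all [pull]
    · exact PEquiv.trans_refl _

end PartialWreath

/-- A chief series of `G`, as the set of its terms: a maximal chain of normal subgroups. -/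
def IsChiefSeries {G : Type*} [Group G] (C : Set {N : Subgroup G // N.Normal}) : Prop :=
  IsMaxChain (· ≤ ·) C

/-- The chief length of a finite group `G`: the maximum length of a chief series, where the length
of a chain is the number of its terms (so both `⊥` and `⊤` are counted, and the trivial group has
chief length `1`). -/
noncomputable def chiefLength (G : Type*) [Group G] : ℕ :=
  sSup {k : ℕ | ∃ C : Set {N : Subgroup G // N.Normal}, IsChiefSeries C ∧ C.ncard = k}

/-! Let `t = nullRank σ` be the largest rank that σ collapses to zero. Related elements of larger
rank have equal domain and image: otherwise a suitable restriction lowers the rank of one side only,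
and that whole rank collapses. So σ amounts to `t` and a normal subgroup of `G ≀ S_m` for each rank
`m > t` (`le_of_localSubgroup_le`). For `m > t + 1` this subgroup lies in the base `G^m`. For `m = t
+ 1` it is determined by its labels and data bounded independently of `m`, since nontrivial normal
subgroups of `S_m` contain `A_m` for `m ≥ 5`; smaller `m` cost a constant.

Upper bound: let `K_m` be the group of labels in rank `m`. Forgetting a coordinate maps `K_(m+1)`
into `K_m`, so the labels that occur alone and the entries that occur at all form two decreasing
sequences `L_m`, `E_m` of normal subgroups of `G`. If `L_(m+1) = L_m`, then `K_(m+1)` consists of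
the vectors over `E_(m+1)` that are constant modulo `L_(m+1)` (`mem_iff_of_singleSubgroup_eq`).
Hence new information appears only where one of the sequences drops, at most `c - 1` times each, and
it is bounded each time. The choice of `t` and of `2(c - 1)` positions gives the order `n^(2c-1)`.

Lower bound: fix a chain of `c` normal subgroups. Each decreasing assignment of its terms to ranks,
with total collapse as an extra top value, yields a congruence that determines the assignment on the
ranks `1, …, n`. Multisets of size `c` in an `n`-set encode such assignments, and there are at least
`n^c / c!` of them. -/

namespace PartialWreath

variable {G : Type*} [Group G] {n : ℕ}

/-! ### Coordinates for elements, and their rank -/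

/-- An injection as a partial equivalence. -/
noncomputable def embeddingPEquiv {α β : Type*} (e : α ↪ β) : α ≃. β where
  toFun a := some (e a)
  invFun := Function.partialInv e
  inv a b := by
    have := e.injective.isPartialInv a b
    simp only [Option.some.injEq]
    exact this

/-- The element of `G ≀ I_n` that sends `e i` to `f i` with label `g i`. -/
noncomputable def ofEmb {α : Type*} (e : α ↪ Fin n) (g : α → G) (f : α ↪ Fin n) :
    PartialWreath G n where
  label i := (Function.partialInv e i).elim 0 fun j => (g j : WithZero G)
  map := (embeddingPEquiv e).symm.trans (embeddingPEquiv f)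
  label_ne_zero_iff i := by
    change _ ↔ ((Function.partialInv e i).bind fun a => some (f a)).isSome
    cases Function.partialInv e i <;> simp

section

variable {α β : Type*}

theorem ofEmb_map_apply (e : α ↪ Fin n) (g : α → G) (f : α ↪ Fin n) (a : α) :
    (ofEmb e g f).map (e a) = some (f a) := by
  change ((Function.partialInv e (e a)).bind fun a => some (f a)) = _
  simp [Function.partialInv_left e.injective]

theorem ofEmb_map_of_notMem (e : α ↪ Fin n) (g : α → G) (f : α ↪ Fin n) {i : Fin n}
    (hi : i ∉ Set.range e) : (ofEmb e g f).map i = none := by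
  change ((Function.partialInv e i).bind fun a => some (f a)) = _
  cases h : Function.partialInv e i with
  | none => rfl
  | some a => exact absurd ⟨a, (e.injective.isPartialInv a i).1 h⟩ hi

theorem ofEmb_label_apply (e : α ↪ Fin n) (g : α → G) (f : α ↪ Fin n) (a : α) :
    (ofEmb e g f).label (e a) = (g a : WithZero G) := by
  change (Function.partialInv e (e a)).elim 0 _ = _
  simp [Function.partialInv_left e.injective]

theorem label_eq_zero {x : PartialWreath G n} {i : Fin n} (h : x.map i = none) :
    x.label i = 0 := by
  by_contra h'
  have := (x.label_ne_zero_iff i).1 h'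
  simp [h] at this

/-- An element is determined by where it is defined and by its values there. -/
theorem eq_ofEmb {x : PartialWreath G n} {e : α ↪ Fin n} {g : α → G} {f : α ↪ Fin n}
    (h1 : ∀ a, x.map (e a) = some (f a)) (h2 : ∀ a, x.label (e a) = (g a : WithZero G))
    (h3 : ∀ i, i ∉ Set.range e → x.map i = none) : x = ofEmb e g f := by
  have key : ∀ i, x.map i = (ofEmb e g f).map i ∧ x.label i = (ofEmb e g f).label i := by
    intro i
    by_cases hi : i ∈ Set.range e
    · obtain ⟨a, rfl⟩ := hi
      exact ⟨by rw [h1, ofEmb_map_apply], by rw [h2, ofEmb_label_apply]⟩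
    · have h := ofEmb_map_of_notMem e g f hi
      exact ⟨by rw [h3 i hi, h], by rw [label_eq_zero (h3 i hi), label_eq_zero h]⟩
  ext1
  · exact funext fun i => (key i).2
  · exact PEquiv.ext fun i => (key i).1

theorem mul_map_apply (x y : PartialWreath G n) (i : Fin n) :
    (x * y).map i = (x.map i).bind y.map := rfl

theorem ofEmb_mul_ofEmb (e f k : α ↪ Fin n) (g h : α → G) :
    ofEmb e g f * ofEmb f h k = ofEmb e (g * h) k := by
  apply eq_ofEmb
  · intro a
    rw [mul_map_apply, ofEmb_map_apply, Option.bind_some, ofEmb_map_apply]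
  · intro a
    rw [mul_label, pull, ofEmb_map_apply, Option.elim_some, ofEmb_label_apply, ofEmb_label_apply]
    simp
  · intro i hi
    rw [mul_map_apply, ofEmb_map_of_notMem _ _ _ hi, Option.bind_none]

/-- Multiplication by a partial identity restricts the domain. -/
theorem ofEmb_restrict (ι : β ↪ α) (e f : α ↪ Fin n) (g : α → G) :
    ofEmb (ι.trans e) 1 (ι.trans e) * ofEmb e g f = ofEmb (ι.trans e) (g ∘ ι) (ι.trans f) := by
  apply eq_ofEmb
  · intro a
    rw [mul_map_apply, ofEmb_map_apply, Option.bind_some]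
    exact ofEmb_map_apply _ _ _ _
  · intro a
    rw [mul_label, pull, ofEmb_map_apply, Option.elim_some, ofEmb_label_apply]
    simp [ofEmb_label_apply]
  · intro i hi
    rw [mul_map_apply, ofEmb_map_of_notMem _ _ _ hi, Option.bind_none]

/-- The pair `e`, `f` matters only up to a common reindexing; this freedom makes the middle
embeddings of two factors agree, as `ofEmb_mul_ofEmb` requires. -/
theorem ofEmb_reindex (π : β ≃ α) (e f : α ↪ Fin n) (g : α → G) :
    ofEmb (π.toEmbedding.trans e) (g ∘ π) (π.toEmbedding.trans f) = ofEmb e g f := by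
  symm
  apply eq_ofEmb
  · exact fun a => ofEmb_map_apply e g f (π a)
  · exact fun a => ofEmb_label_apply e g f (π a)
  · intro i hi
    apply ofEmb_map_of_notMem
    rintro ⟨a, rfl⟩
    exact hi ⟨π.symm a, by simp⟩

end

/-- The domain of the underlying partial map. -/
def dom (x : PartialWreath G n) : Finset (Fin n) :=
  Finset.univ.filter fun i => (x.map i).isSome

/-- The image of the underlying partial map. -/
def ran (x : PartialWreath G n) : Finset (Fin n) :=
  Finset.univ.filter fun i => (x.map.symm i).isSome

/-- The rank of the underlying partial map. -/
def rank (x : PartialWreath G n) : ℕ := x.dom.card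

theorem mem_dom {x : PartialWreath G n} {i : Fin n} : i ∈ x.dom ↔ ∃ j, x.map i = some j := by
  simp [dom, Option.isSome_iff_exists]

theorem mem_ran {x : PartialWreath G n} {j : Fin n} : j ∈ x.ran ↔ ∃ i, x.map i = some j := by
  simp [ran, Option.isSome_iff_exists, PEquiv.eq_some_iff]

theorem mem_dom_ofEmb {α : Type*} {e f : α ↪ Fin n} {g : α → G} {i : Fin n} :
    i ∈ (ofEmb e g f).dom ↔ ∃ a, e a = i := by
  rw [mem_dom]
  constructor
  · rintro ⟨j, hj⟩
    by_contra h
    rw [ofEmb_map_of_notMem e g f h] at hj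
    simp at hj
  · rintro ⟨a, rfl⟩
    exact ⟨_, ofEmb_map_apply e g f a⟩

theorem mem_ran_ofEmb {α : Type*} {e f : α ↪ Fin n} {g : α → G} {j : Fin n} :
    j ∈ (ofEmb e g f).ran ↔ ∃ a, f a = j := by
  rw [mem_ran]
  constructor
  · rintro ⟨i, hi⟩
    obtain ⟨a, rfl⟩ := mem_dom_ofEmb.1 (mem_dom.2 ⟨j, hi⟩)
    rw [ofEmb_map_apply] at hi
    exact ⟨a, Option.some.inj hi⟩
  · rintro ⟨a, rfl⟩
    exact ⟨_, ofEmb_map_apply e g f a⟩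

theorem rank_ofEmb {m : ℕ} (e f : Fin m ↪ Fin n) (g : Fin m → G) :
    (ofEmb e g f).rank = m := by
  have : (ofEmb e g f).dom = Finset.univ.map e := by
    ext i
    simp [mem_dom_ofEmb]
  simp [rank, this]

theorem exists_eq_ofEmb (x : PartialWreath G n) :
    ∃ (e : Fin x.rank ↪ Fin n) (g : Fin x.rank → G) (f : Fin x.rank ↪ Fin n),
      x = ofEmb e g f := by
  obtain ⟨e, he, he'⟩ : ∃ e : Fin x.rank ↪ Fin n, (∀ a, e a ∈ x.dom) ∧
      ∀ i ∈ x.dom, i ∈ Set.range e :=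
    ⟨x.dom.equivFin.symm.toEmbedding.trans (Function.Embedding.subtype _),
      fun a => (x.dom.equivFin.symm a).2,
      fun i hi => ⟨x.dom.equivFin ⟨i, hi⟩,
        congrArg Subtype.val (x.dom.equivFin.symm_apply_apply ⟨i, hi⟩)⟩⟩
  choose f hf using fun a => mem_dom.1 (he a)
  have hl (a : Fin x.rank) : x.label (e a) ≠ 0 := (x.label_ne_zero_iff _).2 (by simp [hf])
  refine ⟨e, fun a => WithZero.unzero (hl a), ⟨f, fun a b hab => ?_⟩, eq_ofEmb hf ?_ ?_⟩
  · exact e.injective (x.map.inj (hf a) (hab ▸ hf b))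
  · intro a
    rw [WithZero.coe_unzero]
  · intro i hi
    by_contra h'
    obtain ⟨j, hj⟩ := Option.ne_none_iff_exists'.1 h'
    exact hi (he' i (mem_dom.2 ⟨j, hj⟩))

theorem card_ran (x : PartialWreath G n) : x.ran.card = x.rank := by
  obtain ⟨e, g, f, h⟩ := exists_eq_ofEmb x
  have : x.ran = Finset.univ.map f := by
    ext i
    have h' : i ∈ x.ran ↔ i ∈ (ofEmb e g f).ran := by rw [← h]
    rw [h', mem_ran_ofEmb]
    simp
  simp [this]

theorem rank_le (x : PartialWreath G n) : x.rank ≤ n :=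
  (Finset.card_le_univ x.dom).trans_eq (Fintype.card_fin n)

theorem dom_mul_subset (x y : PartialWreath G n) : (x * y).dom ⊆ x.dom := by
  intro i hi
  obtain ⟨j, hj⟩ := mem_dom.1 hi
  rw [mul_map_apply, Option.bind_eq_some_iff] at hj
  obtain ⟨a, ha, -⟩ := hj
  exact mem_dom.2 ⟨a, ha⟩

theorem ran_mul_subset (x y : PartialWreath G n) : (x * y).ran ⊆ y.ran := by
  intro j hj
  obtain ⟨i, hi⟩ := mem_ran.1 hj
  rw [mul_map_apply, Option.bind_eq_some_iff] at hi
  obtain ⟨a, -, ha⟩ := hi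
  exact mem_ran.2 ⟨a, ha⟩

theorem rank_mul_le_left (x y : PartialWreath G n) : (x * y).rank ≤ x.rank :=
  Finset.card_le_card (dom_mul_subset x y)

theorem rank_mul_le_right (x y : PartialWreath G n) : (x * y).rank ≤ y.rank := by
  rw [← card_ran, ← card_ran]
  exact Finset.card_le_card (ran_mul_subset x y)

/-- The element of rank zero. -/
noncomputable instance : Zero (PartialWreath G n) where
  zero := ofEmb (Function.Embedding.ofIsEmpty : Empty ↪ Fin n) 1 Function.Embedding.ofIsEmpty

theorem dom_zero : (0 : PartialWreath G n).dom = ∅ := by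
  ext i
  change i ∈ (ofEmb _ _ _).dom ↔ _
  simp [mem_dom_ofEmb]

theorem rank_zero : (0 : PartialWreath G n).rank = 0 := by simp [rank, dom_zero]

theorem eq_zero_of_rank {x : PartialWreath G n} (h : x.rank = 0) : x = 0 := by
  apply eq_ofEmb
  · exact fun a => a.elim
  · exact fun a => a.elim
  · intro i _
    have : i ∉ x.dom := by simp [Finset.card_eq_zero.1 h]
    simpa [dom] using this

theorem zero_mul' (x : PartialWreath G n) : 0 * x = 0 :=
  eq_zero_of_rank (Nat.le_zero.1 ((rank_mul_le_left 0 x).trans_eq rank_zero))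

theorem mul_zero' (x : PartialWreath G n) : x * 0 = 0 :=
  eq_zero_of_rank (Nat.le_zero.1 ((rank_mul_le_right x 0).trans_eq rank_zero))

end PartialWreath

/-! ### Congruences in terms of normal subgroups of `G ≀ S_m` -/

/-- The wreath product `G ≀ S_m`. -/
abbrev WreathPerm (G : Type*) [Group G] (m : ℕ) :=
  (Fin m → G) ⋊[mulAutArrow (G := Equiv.Perm (Fin m)) (A := Fin m) (M := G)] Equiv.Perm (Fin m)

theorem mulAutArrow_perm_apply {G : Type*} [Group G] {m : ℕ} (π : Equiv.Perm (Fin m))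
    (g : Fin m → G) : (mulAutArrow (G := Equiv.Perm (Fin m)) (A := Fin m) (M := G)) π g
      = g ∘ ⇑π⁻¹ := rfl

namespace PartialWreath

variable {G : Type*} [Group G] {n m : ℕ}

theorem exists_eq_ofEmb_of_rank {x : PartialWreath G n} (h : x.rank = m) :
    ∃ (e : Fin m ↪ Fin n) (g : Fin m → G) (f : Fin m ↪ Fin n), x = ofEmb e g f := by
  subst h
  exact exists_eq_ofEmb x

/-- The action of `G ≀ S_m` on the image of an injection. -/
noncomputable def ofWreath (e : Fin m ↪ Fin n) (w : WreathPerm G m) : PartialWreath G n :=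
  ofEmb e w.left ((w.right⁻¹).toEmbedding.trans e)

theorem ofWreath_one (e : Fin m ↪ Fin n) : ofWreath e (1 : WreathPerm G m) = ofEmb e 1 e := rfl

theorem ofWreath_mul_ofEmb (e f : Fin m ↪ Fin n) (w : WreathPerm G m) (g : Fin m → G) :
    ofWreath e w * ofEmb e g f
      = ofEmb e (w.left * g ∘ ⇑w.right⁻¹) ((w.right⁻¹).toEmbedding.trans f) := by
  rw [← ofEmb_reindex (w.right⁻¹) e f g, ofWreath, ofEmb_mul_ofEmb]

/-- Partial maps compose from left to right and permutations from right to left; the inverse in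
`ofWreath` makes it multiplicative. -/
theorem ofWreath_mul (e : Fin m ↪ Fin n) (v w : WreathPerm G m) :
    ofWreath e v * ofWreath e w = ofWreath e (v * w) := by
  rw [ofWreath, ofWreath, ← ofWreath, ofWreath_mul_ofEmb, ofWreath]
  congr 1

variable (σ τ : Con (PartialWreath G n))

/-- All elements of rank at most `m` are identified with zero. -/
def NullUpTo (m : ℕ) : Prop := ∀ x : PartialWreath G n, x.rank ≤ m → σ x 0

theorem nullUpTo_zero : NullUpTo σ 0 := by
  intro x hx
  rw [eq_zero_of_rank (Nat.le_zero.1 hx)]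
  exact σ.refl 0

variable {σ τ}

/-- Restricting both sides to an `s`-subset of `x.dom` through `i` keeps rank `s` on the left and
drops the rank on the right. By induction on `s` the right side is null, hence so is one element of
rank `s`, and its multiples include all the others. -/
theorem nullUpTo_of_notMem_dom {x y : PartialWreath G n} (h : σ x y) {i : Fin n}
    (hi : i ∈ x.dom) (hi' : i ∉ y.dom) : NullUpTo σ x.rank := by
  obtain ⟨m, hm⟩ : ∃ m, x.rank = m := ⟨_, rfl⟩
  rw [hm]
  obtain ⟨e, g, f, rfl⟩ := exists_eq_ofEmb_of_rank hm
  obtain ⟨a, rfl⟩ := mem_dom_ofEmb.1 hi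
  suffices H : ∀ s, s ≤ m → ∀ x : PartialWreath G n, x.rank = s → σ x 0 from
    fun x hx => H _ hx x rfl
  intro s
  induction s using Nat.strong_induction_on with
  | _ s ih =>
    intro hs x hx
    rcases Nat.eq_zero_or_pos s with h0 | h0
    · exact nullUpTo_zero σ x (hx.trans h0).le
    obtain ⟨e', g', f', rfl⟩ := exists_eq_ofEmb_of_rank hx
    -- The standard inclusion, followed by a transposition that moves its first value to `a`.
    obtain ⟨ι, b, rfl⟩ : ∃ (ι : Fin s ↪ Fin m) (b : Fin s), ι b = a :=
      ⟨(Fin.castLEEmb hs).trans (Equiv.swap (Fin.castLE hs ⟨0, h0⟩) a).toEmbedding,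
        ⟨0, h0⟩, by simp⟩
    have h1 := σ.mul (σ.refl (ofEmb (ι.trans e) 1 (ι.trans e))) h
    rw [ofEmb_restrict] at h1
    have h2 : (ofEmb (ι.trans e) 1 (ι.trans e) * y).rank < s := by
      have hss : (ofEmb (ι.trans e) 1 (ι.trans e) * y).dom
          ⊂ (ofEmb (ι.trans e) (1 : Fin s → G) (ι.trans e)).dom := by
        refine Finset.ssubset_iff_subset_ne.2 ⟨dom_mul_subset _ _, fun heq => ?_⟩
        have hmem : e (ι b) ∈ (ofEmb (ι.trans e) 1 (ι.trans e) * y).dom := by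
          rw [heq]
          exact mem_dom_ofEmb.2 ⟨b, rfl⟩
        obtain ⟨j, hj⟩ := mem_dom.1 hmem
        have : (ofEmb (ι.trans e) (1 : Fin s → G) (ι.trans e)).map (e (ι b)) = some (e (ι b)) :=
          ofEmb_map_apply (ι.trans e) 1 (ι.trans e) b
        rw [mul_map_apply, this, Option.bind_some] at hj
        exact hi' (mem_dom.2 ⟨j, hj⟩)
      exact (Finset.card_lt_card hss).trans_eq (rank_ofEmb _ _ _)
    have h3 := σ.trans h1 (ih _ h2 (h2.le.trans hs) _ rfl)
    -- The outer factors turn the null element into `ofEmb e' g' f'`; the left label cancels `g ∘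
    -- ι`.
    have h4 := σ.mul (σ.mul (σ.refl (ofEmb e' (g' * (g ∘ ι)⁻¹) (ι.trans e))) h3)
      (σ.refl (ofEmb (ι.trans f) 1 f'))
    rw [ofEmb_mul_ofEmb, ofEmb_mul_ofEmb, mul_zero', zero_mul'] at h4
    simpa using h4

theorem nullUpTo_of_rank_lt {x y : PartialWreath G n} (h : σ x y) (hr : y.rank < x.rank) :
    NullUpTo σ x.rank := by
  obtain ⟨i, hi, hi'⟩ := Finset.exists_mem_notMem_of_card_lt_card hr
  exact nullUpTo_of_notMem_dom h hi hi'

/-- The partial identity on `x.ran` fixes `x` from the right but lowers the rank of `y` below that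
of `x`. -/
theorem nullUpTo_of_notMem_ran {x y : PartialWreath G n} (h : σ x y) {i : Fin n}
    (hi : i ∈ x.ran) (hi' : i ∉ y.ran) : NullUpTo σ x.rank := by
  obtain ⟨m, hm⟩ : ∃ m, x.rank = m := ⟨_, rfl⟩
  obtain ⟨e, g, f, rfl⟩ := exists_eq_ofEmb_of_rank hm
  have h1 := σ.mul h (σ.refl (ofEmb f 1 f))
  rw [ofEmb_mul_ofEmb, mul_one] at h1
  refine nullUpTo_of_rank_lt h1 ?_
  rw [rank_ofEmb, ← card_ran]
  have hss : (y * ofEmb f 1 f).ran ⊂ (ofEmb f (1 : Fin m → G) f).ran := by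
    refine Finset.ssubset_iff_subset_ne.2 ⟨ran_mul_subset _ _, fun heq => hi' ?_⟩
    have hmem : i ∈ (y * ofEmb f 1 f).ran := by
      rw [heq]
      exact mem_ran_ofEmb.2 (mem_ran_ofEmb.1 hi)
    obtain ⟨j, hj⟩ := mem_ran.1 hmem
    rw [mul_map_apply, Option.bind_eq_some_iff] at hj
    obtain ⟨k, hk, hk'⟩ := hj
    obtain ⟨b, rfl⟩ := mem_dom_ofEmb.1 (mem_dom.2 ⟨i, hk'⟩)
    rw [ofEmb_map_apply] at hk'
    exact mem_ran.2 ⟨j, hk.trans hk'⟩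
  have := Finset.card_lt_card hss
  rwa [card_ran (ofEmb f 1 f), rank_ofEmb] at this

theorem nullUpTo_of_rel_zero {x : PartialWreath G n} (h : σ x 0) : NullUpTo σ x.rank := by
  rcases Nat.eq_zero_or_pos x.rank with h0 | h0
  · rw [h0]
    exact nullUpTo_zero σ
  · exact nullUpTo_of_rank_lt h (by rwa [rank_zero])

theorem dom_eq_of_rel {x y : PartialWreath G n} (h : σ x y) (hx : ¬ NullUpTo σ x.rank)
    (hy : ¬ NullUpTo σ y.rank) : x.dom = y.dom := by
  ext i
  exact ⟨fun hi => by_contra fun hi' => hx (nullUpTo_of_notMem_dom h hi hi'),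
    fun hi => by_contra fun hi' => hy (nullUpTo_of_notMem_dom (σ.symm h) hi hi')⟩

theorem ran_eq_of_rel {x y : PartialWreath G n} (h : σ x y) (hx : ¬ NullUpTo σ x.rank)
    (hy : ¬ NullUpTo σ y.rank) : x.ran = y.ran := by
  ext i
  exact ⟨fun hi => by_contra fun hi' => hx (nullUpTo_of_notMem_ran h hi hi'),
    fun hi => by_contra fun hi' => hy (nullUpTo_of_notMem_ran (σ.symm h) hi hi')⟩

open Classical in
/-- The largest rank of an element that is identified with zero. -/
noncomputable def nullRank (σ : Con (PartialWreath G n)) : ℕ := Nat.findGreatest (NullUpTo σ) n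

theorem nullRank_le : nullRank σ ≤ n := by
  classical
  exact Nat.findGreatest_le n

theorem nullUpTo_iff (hm : m ≤ n) : NullUpTo σ m ↔ m ≤ nullRank σ := by
  classical
  refine ⟨fun h => Nat.le_findGreatest hm h, fun h x hx => ?_⟩
  exact Nat.findGreatest_spec (P := NullUpTo σ) (Nat.zero_le n) (nullUpTo_zero σ) x (hx.trans h)

theorem rel_zero_iff {x : PartialWreath G n} : σ x 0 ↔ x.rank ≤ nullRank σ := by
  rw [← nullUpTo_iff (rank_le x)]
  exact ⟨nullUpTo_of_rel_zero, fun h => h x le_rfl⟩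

theorem rel_ofWreath_one_of_emb {w : WreathPerm G m} {e : Fin m ↪ Fin n}
    (h : σ (ofWreath e w) (ofWreath e 1)) (f : Fin m ↪ Fin n) :
    σ (ofWreath f w) (ofWreath f 1) := by
  have h1 := σ.mul (σ.mul (σ.refl (ofEmb f 1 e)) h) (σ.refl (ofEmb e 1 f))
  rw [ofWreath_one, ofEmb_mul_ofEmb, ofEmb_mul_ofEmb, ofWreath, ofEmb_mul_ofEmb,
    ← ofEmb_reindex (w.right⁻¹) e f 1, ofEmb_mul_ofEmb] at h1
  have h2 : (1 : Fin m → G) * w.left * (1 : Fin m → G) ∘ ⇑w.right⁻¹ = w.left := by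
    ext i
    simp
  rw [h2, mul_one, mul_one] at h1
  exact h1

/-- The elements of `G ≀ S_m` whose action in rank `m` is identified with that of the identity. -/
noncomputable def localSubgroup (σ : Con (PartialWreath G n)) (m : ℕ) : Subgroup (WreathPerm G m) where
  carrier := {w | ∀ e : Fin m ↪ Fin n, σ (ofWreath e w) (ofWreath e 1)}
  mul_mem' {v w} hv hw e := by
    have := σ.mul (hv e) (hw e)
    rwa [ofWreath_mul, ofWreath_mul, mul_one] at this
  one_mem' e := σ.refl _
  inv_mem' {w} hw e := by
    have := σ.mul (hw e) (σ.refl (ofWreath e w⁻¹))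
    rw [ofWreath_mul, ofWreath_mul, mul_inv_cancel, one_mul] at this
    exact σ.symm this

theorem mem_localSubgroup_of_emb {w : WreathPerm G m} {e : Fin m ↪ Fin n}
    (h : σ (ofWreath e w) (ofWreath e 1)) : w ∈ localSubgroup σ m :=
  fun f => rel_ofWreath_one_of_emb h f

instance : (localSubgroup σ m).Normal where
  conj_mem w hw v e := by
    have := σ.mul (σ.mul (σ.refl (ofWreath e v)) (hw e)) (σ.refl (ofWreath e v⁻¹))
    simp only [ofWreath_mul] at this
    simpa using this

/-- Above the null rank, related `x` and `y` share domain and image, so `y = w x` for some `w` in `G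
≀ S_m`. Cancelling `x` shows that `w` lies in the local subgroup. -/
theorem le_of_localSubgroup_le (ht : nullRank σ = nullRank τ)
    (h : ∀ m, nullRank σ < m → localSubgroup σ m ≤ localSubgroup τ m) : σ ≤ τ := by
  intro x y hxy
  by_cases hx : x.rank ≤ nullRank σ
  · have hx' := rel_zero_iff.2 hx
    have hy' := rel_zero_iff.1 (σ.trans (σ.symm hxy) hx')
    exact τ.trans (rel_zero_iff.2 (hx.trans_eq ht)) (τ.symm (rel_zero_iff.2 (hy'.trans_eq ht)))
  have hy : ¬ y.rank ≤ nullRank σ := fun hy => hx (rel_zero_iff.1 (σ.trans hxy (rel_zero_iff.2 hy)))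
  rw [← nullUpTo_iff (rank_le _)] at hx hy
  have hd := dom_eq_of_rel hxy hx hy
  have hr := ran_eq_of_rel hxy hx hy
  obtain ⟨m, hm⟩ : ∃ m, x.rank = m := ⟨_, rfl⟩
  obtain ⟨e, g, f, rfl⟩ := exists_eq_ofEmb_of_rank hm
  have hmem (a : Fin m) : ∃ b h, y.map (e a) = some (f b) ∧ y.label (e a) = ((h : G) : WithZero G) := by
    obtain ⟨j, hj⟩ := mem_dom.1 (hd ▸ mem_dom_ofEmb.2 ⟨a, rfl⟩ : e a ∈ y.dom)
    obtain ⟨b, rfl⟩ := mem_ran_ofEmb.1 (hr ▸ mem_ran.2 ⟨_, hj⟩ : j ∈ (ofEmb e g f).ran)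
    obtain ⟨h, hh⟩ := WithZero.ne_zero_iff_exists.1
      ((y.label_ne_zero_iff (e a)).2 (by rw [hj]; rfl))
    exact ⟨b, h, hj, hh.symm⟩
  choose p k hp hk using hmem
  have hinj : Function.Injective p := fun a b hab =>
    e.injective (y.map.inj (hp a) (hab ▸ hp b))
  let π : Equiv.Perm (Fin m) := Equiv.ofBijective p (Finite.injective_iff_bijective.1 hinj)
  have hy' : y = ofEmb e k (π.toEmbedding.trans f) := by
    refine eq_ofEmb hp hk fun i hi => ?_
    have : i ∉ y.dom := by
      rw [← hd, mem_dom_ofEmb]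
      exact hi
    simpa [dom] using this
  let w : WreathPerm G m := ⟨k * (g⁻¹ ∘ π), π⁻¹⟩
  have hw (u : Fin m → G) : ofWreath e w * ofEmb e u f
      = ofEmb e (k * (g⁻¹ ∘ π) * u ∘ π) (π.toEmbedding.trans f) := by
    rw [ofWreath_mul_ofEmb]
    simp [w]
  have hwx : ofWreath e w * ofEmb e g f = y := by
    rw [hw, hy']
    congr 1
    ext i
    simp
  have hwm : w ∈ localSubgroup σ m := by
    apply mem_localSubgroup_of_emb (e := e)
    have := σ.mul (σ.symm hxy) (σ.refl (ofEmb f g⁻¹ e))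
    rw [← hwx, mul_assoc, ofEmb_mul_ofEmb, mul_inv_cancel, ← ofWreath_one, ofWreath_mul,
      mul_one] at this
    exact this
  have hlt : nullRank σ < m := by
    rw [rank_ofEmb, nullUpTo_iff (by simpa [rank_ofEmb] using rank_le (ofEmb e g f))] at hx
    omega
  have h1 := τ.mul (h m hlt hwm e) (τ.refl (ofEmb e g f))
  rw [hwx, ofWreath_one, ofEmb_mul_ofEmb, one_mul] at h1
  exact τ.symm h1

/-- Above the lowest nonzero rank a congruence does not change the underlying partial maps. -/
theorem right_eq_one_of_mem_localSubgroup (hm : m ≤ n) (ht : nullRank σ + 1 < m)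
    {w : WreathPerm G m} (hw : w ∈ localSubgroup σ m) : w.right = 1 := by
  by_contra hne
  obtain ⟨i, hi⟩ : ∃ i, w.right⁻¹ i ≠ i := by
    by_contra! H
    exact hne (inv_eq_one.1 (Equiv.ext H))
  obtain ⟨s, hs⟩ : ∃ s, s = nullRank σ + 1 := ⟨_, rfl⟩
  -- A set of size `t + 1` that contains `i` but not its image exists because `t + 1 < m`.
  -- Restricted to it, `w` and the identity have different images, so rank `t + 1` would collapse.
  obtain ⟨A, hA, hA', hAc⟩ : ∃ A : Finset (Fin m), {i} ⊆ A ∧ A ⊆ {w.right⁻¹ i}ᶜ ∧ A.card = s := by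
    apply Finset.exists_subsuperset_card_eq
    · simpa only [Finset.singleton_subset_iff, Finset.mem_compl, Finset.mem_singleton] using hi.symm
    · simp [hs]
    · rw [Finset.card_compl, Finset.card_singleton, Fintype.card_fin]
      omega
  let ι : Fin s ↪ Fin m := (A.orderEmbOfFin hAc).toEmbedding
  have hι (j) : j ∈ A ↔ ∃ a, ι a = j := by
    rw [← Finset.mem_coe, ← Finset.range_orderEmbOfFin A hAc]
    rfl
  let e : Fin m ↪ Fin n := Fin.castLEEmb hm
  have h1 := σ.mul (σ.refl (ofEmb (ι.trans e) 1 (ι.trans e))) (hw e)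
  rw [ofWreath_one, ofWreath, ofEmb_restrict, ofEmb_restrict] at h1
  have h2 : NullUpTo σ s := by
    rw [← rank_ofEmb (ι.trans e) (ι.trans ((w.right⁻¹).toEmbedding.trans e)) (w.left ∘ ι)]
    obtain ⟨a, ha⟩ := (hι i).1 (hA (Finset.mem_singleton_self i))
    refine nullUpTo_of_notMem_ran h1 (i := e (w.right⁻¹ i)) ?_ ?_
    · exact mem_ran_ofEmb.2 ⟨a, by simp [ha]⟩
    · rw [mem_ran_ofEmb]
      rintro ⟨b, hb⟩
      have hb' : ι b = w.right⁻¹ i := e.injective hb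
      have := hA' ((hι _).2 ⟨b, hb'⟩)
      simp at this
  rw [nullUpTo_iff (by omega)] at h2
  omega

/-- The part of the local subgroup that consists of labels. -/
noncomputable def baseSubgroup (σ : Con (PartialWreath G n)) (m : ℕ) : Subgroup (Fin m → G) :=
  (localSubgroup σ m).comap SemidirectProduct.inl

/-- Left multiplication by a partial identity of rank `m` forgets a coordinate; this is the link
between consecutive ranks. -/
theorem restrict_mem_baseSubgroup (hm : m + 1 ≤ n) {g : Fin (m + 1) → G}
    (hg : g ∈ baseSubgroup σ (m + 1)) : g ∘ Fin.castSucc ∈ baseSubgroup σ m := by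
  let e : Fin (m + 1) ↪ Fin n := Fin.castLEEmb hm
  let ι : Fin m ↪ Fin (m + 1) := Fin.castSuccEmb
  apply mem_localSubgroup_of_emb (e := ι.trans e)
  have := σ.mul (σ.refl (ofEmb (ι.trans e) 1 (ι.trans e))) (hg e)
  rwa [ofWreath_one, ofWreath, ofEmb_restrict, ofEmb_restrict] at this

end PartialWreath

/-! ### Permutation invariant subgroups of a power of `G` -/

section PowerSubgroups

open Pi (mulSingle)

variable {G : Type*} [Group G] {ι : Type*} [DecidableEq ι]

/-- A subgroup of a power of `G` that is stable under permutations of the coordinates. -/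
def PermInvariant (K : Subgroup (ι → G)) : Prop :=
  ∀ (π : Equiv.Perm ι), ∀ g ∈ K, g ∘ π ∈ K

theorem mulSingle_comp_perm (π : Equiv.Perm ι) (i : ι) (x : G) :
    (mulSingle i x : ι → G) ∘ π = mulSingle (π.symm i) x := by
  ext j
  by_cases h : j = π.symm i
  · subst h
    simp
  · have : π j ≠ i := fun h' => h (by simp [← h'])
    simp [h, this]

variable {K K' : Subgroup (ι → G)}

/-- The quotient of `g` and its image under a transposition is supported on two coordinates. -/
theorem PermInvariant.mulSingle_mul_mem (hK : PermInvariant K) {g : ι → G} (hg : g ∈ K)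
    {i j : ι} (hij : i ≠ j) :
    mulSingle i ((g i)⁻¹ * g j) * mulSingle j ((g j)⁻¹ * g i) ∈ K := by
  have h := K.mul_mem (K.inv_mem hg) (hK (Equiv.swap i j) g hg)
  convert h using 1
  ext k
  by_cases hi : k = i
  · subst hi
    simp [hij]
  · by_cases hj : k = j
    · subst hj
      simp [hij.symm]
    · simp [hi, hj, Equiv.swap_apply_of_ne_of_ne]

theorem PermInvariant.mulSingle_mul_mem_of_ne (hK : PermInvariant K) {x y : G} {i j i' j' : ι}
    (hij : i ≠ j) (hij' : i' ≠ j') (h : mulSingle i x * mulSingle j y ∈ K) :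
    mulSingle i' x * mulSingle j' y ∈ K := by
  obtain ⟨π, hi, hj⟩ : ∃ π : Equiv.Perm ι, π i' = i ∧ π j' = j := by
    refine ⟨(Equiv.swap i' i).trans (Equiv.swap (Equiv.swap i' i j') j), ?_, ?_⟩
    · rw [Equiv.trans_apply, Equiv.swap_apply_left]
      refine Equiv.swap_apply_of_ne_of_ne (fun h' => hij' ?_) hij
      rw [← (Equiv.swap i' i).injective.eq_iff, Equiv.swap_apply_left]
      exact h'
    · simp
  have := hK π _ h
  have e : (mulSingle i x * mulSingle j y : ι → G) ∘ π
      = ((mulSingle i x : ι → G) ∘ π) * ((mulSingle j y : ι → G) ∘ π) := rfl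
  rwa [e, mulSingle_comp_perm, mulSingle_comp_perm, ← hi, ← hj, Equiv.symm_apply_apply,
    Equiv.symm_apply_apply] at this

/-- Entries away from `i` can be replaced along a subgroup, at the expense of the entry at `i`. -/
theorem exists_inv_mul_update_mem [Fintype ι] (g u : ι → G) (i : ι)
    (h : ∀ j, j ≠ i → ∃ y, mulSingle i y * mulSingle j ((g j)⁻¹ * u j) ∈ K) :
    ∃ x, g⁻¹ * Function.update u i x ∈ K := by
  have key : ∀ s : Finset ι, i ∉ s → ∃ x, g⁻¹ * (fun k => if k ∈ s then u k else
      if k = i then x else g k) ∈ K := by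
    intro s
    induction s using Finset.induction_on with
    | empty =>
      intro _
      refine ⟨g i, ?_⟩
      convert K.one_mem using 1
      ext k
      by_cases hk : k = i <;> simp [hk]
    | insert j s hj ih =>
      intro hi
      simp only [Finset.mem_insert, not_or] at hi
      obtain ⟨x, hx⟩ := ih hi.2
      obtain ⟨y, hy⟩ := h j (Ne.symm hi.1)
      refine ⟨x * y, ?_⟩
      convert K.mul_mem hx hy using 1
      ext k
      by_cases hk : k = i
      · subst hk
        simp [hi.1, hi.2, mul_assoc]
      · by_cases hkj : k = j
        · subst hkj
          simp [hj, hk]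
        · simp [hk, hkj]
  obtain ⟨x, hx⟩ := key (Finset.univ.erase i) (by simp)
  refine ⟨x, ?_⟩
  convert hx using 2
  ext k
  by_cases hk : k = i
  · subst hk
    simp
  · simp [hk]

/-- Two-point elements lying in both subgroups make `g` constant away from `i`, so it suffices to
compare two-point and almost constant vectors. The index `j'` may depend on `j` so that `h1` is
vacuous when `i` is the only coordinate. -/
theorem PermInvariant.le_of_data [Fintype ι] (hK : PermInvariant K) (hK' : PermInvariant K') (i : ι)
    (h1 : ∀ j, j ≠ i → ∃ j', j' ≠ i ∧
      ∀ d, mulSingle i d * mulSingle j' d⁻¹ ∈ K → mulSingle i d * mulSingle j' d⁻¹ ∈ K')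
    (h2 : ∀ x z, Function.update (fun _ => z) i x ∈ K → Function.update (fun _ => z) i x ∈ K') :
    K ≤ K' := by
  intro g hg
  obtain ⟨x, hx⟩ : ∃ x, g⁻¹ * Function.update (fun _ => g i) i x ∈ K ⊓ K' := by
    refine exists_inv_mul_update_mem g (fun _ => g i) i fun j hj => ⟨(g i)⁻¹ * g j, ?_⟩
    obtain ⟨j', hj', hd⟩ := h1 j hj
    have h := hK.mulSingle_mul_mem hg hj.symm
    have e : (g j)⁻¹ * g i = ((g i)⁻¹ * g j)⁻¹ := by simp
    rw [e] at h ⊢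
    exact ⟨h, hK'.mulSingle_mul_mem_of_ne hj'.symm hj.symm
      (hd _ (hK.mulSingle_mul_mem_of_ne hj.symm hj'.symm h))⟩
  have hv := h2 _ _ (by simpa using K.mul_mem hg hx.1)
  simpa using K'.mul_mem hv (K'.inv_mem hx.2)

variable (K) in
/-- The labels that may occur alone in a single coordinate. -/
def singleSubgroup : Subgroup G := ⨅ i, K.comap (MonoidHom.mulSingle (fun _ => G) i)

variable (K) in
/-- The labels that occur in some coordinate. -/
def entrySubgroup : Subgroup G := ⨆ i, K.map (Pi.evalMonoidHom (fun _ => G) i)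

instance [K.Normal] : (singleSubgroup K).Normal :=
  Subgroup.normal_iInf_normal fun _ => inferInstance

instance [K.Normal] : (entrySubgroup K).Normal :=
  haveI (i : ι) : (K.map (Pi.evalMonoidHom (fun _ => G) i)).Normal :=
    Subgroup.Normal.map ‹_› _ (Function.surjective_eval i)
  Subgroup.iSup_normal _

theorem PermInvariant.mem_singleSubgroup (hK : PermInvariant K) (i : ι) {x : G} :
    x ∈ singleSubgroup K ↔ (mulSingle i x : ι → G) ∈ K := by
  simp only [singleSubgroup, Subgroup.mem_iInf, Subgroup.mem_comap, MonoidHom.mulSingle_apply]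
  refine ⟨fun h => h i, fun h j => ?_⟩
  have := hK (Equiv.swap i j) _ h
  rwa [mulSingle_comp_perm, Equiv.symm_swap, Equiv.swap_apply_left] at this

theorem PermInvariant.mem_entrySubgroup (hK : PermInvariant K) (i : ι) {x : G} :
    x ∈ entrySubgroup K ↔ ∃ g ∈ K, g i = x := by
  have h : entrySubgroup K = K.map (Pi.evalMonoidHom (fun _ => G) i) := by
    refine le_antisymm (iSup_le fun j => ?_) (le_iSup (fun i => K.map (Pi.evalMonoidHom _ i)) i)
    rintro _ ⟨g, hg, rfl⟩
    exact ⟨g ∘ Equiv.swap i j, hK _ g hg, by simp⟩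
  simp [h]

theorem PermInvariant.mem_of_forall_mem_singleSubgroup [Fintype ι] (hK : PermInvariant K)
    {g : ι → G} (h : ∀ i, g i ∈ singleSubgroup K) : g ∈ K := by
  rw [← Subgroup.mem_toSubmonoid]
  exact Submonoid.pi_mem_of_mulSingle_mem g fun i => (hK.mem_singleSubgroup i).1 (h i)

end PowerSubgroups

/-! ### Normal subgroups of `G ≀ S_m` -/

section WreathSubgroups

open Pi (mulSingle)

open SemidirectProduct (inl inr)

variable {G : Type*} [Group G] {m : ℕ} {N N' : Subgroup (WreathPerm G m)} [N.Normal] [N'.Normal]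

theorem permInvariant_comap_inl (N : Subgroup (WreathPerm G m)) [N.Normal] :
    PermInvariant (N.comap inl) := by
  intro π g hg
  have := Subgroup.Normal.conj_mem ‹N.Normal› _ hg (inr π⁻¹)
  rwa [← map_inv, ← SemidirectProduct.inl_aut] at this

theorem mul_inl_mul_inv (w : WreathPerm G m) (s : Fin m → G) :
    w * inl s * w⁻¹ = inl (w.left * s ∘ ⇑w.right⁻¹ * w.left⁻¹) := by
  have h := SemidirectProduct.inl_left_mul_inr_right w
  rw [← mulAutArrow_perm_apply, map_mul, map_mul, SemidirectProduct.inl_aut, map_inv, map_inv]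
  conv_lhs => rw [← h]
  group

/-- The commutator of `w` with a label `h` at a moved point `p` has entries `c h c⁻¹` at `w.right p`
and `h⁻¹` at `p` (claim `A`). Commutators of such elements with single labels put commutators of `G`
into one coordinate (claim `B`), which removes the twist by `c`. -/
theorem mulSingle_mul_mem_of_right_ne_one {w : WreathPerm G m} (hw : w ∈ N) (h1 : w.right ≠ 1)
    {i j : Fin m} (hij : i ≠ j) (x : G) :
    mulSingle i x * mulSingle j x⁻¹ ∈ N.comap inl := by
  obtain ⟨p, hp⟩ : ∃ p, w.right p ≠ p := by
    by_contra! H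
    exact h1 (Equiv.ext H)
  have hK := permInvariant_comap_inl N
  set K := N.comap inl with hKdef
  have : K.Normal := inferInstanceAs (N.comap inl).Normal
  set c := w.left (w.right p) with hc
  have A (h : G) {i j : Fin m} (hij : i ≠ j) :
      mulSingle i (c * h * c⁻¹) * mulSingle j h⁻¹ ∈ K := by
    refine hK.mulSingle_mul_mem_of_ne hp hij ?_
    have := N.mul_mem hw (Subgroup.Normal.conj_mem ‹N.Normal› _ (N.inv_mem hw) (inl (mulSingle p h)))
    rw [← mul_assoc, ← mul_assoc, mul_inl_mul_inv, ← map_inv, ← map_mul] at this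
    convert Subgroup.mem_comap.2 this using 1
    ext k
    by_cases hkp : k = p
    · subst hkp
      have h' : w.right⁻¹ k ≠ k := fun h' => hp (Equiv.Perm.inv_eq_iff_eq.1 h').symm
      simp [hp.symm, h', -Equiv.Perm.coe_inv]
    · by_cases hkq : k = w.right p
      · subst hkq
        simp [hp, hc]
      · have h' : w.right⁻¹ k ≠ p := fun h' => hkq (Equiv.Perm.inv_eq_iff_eq.1 h')
        simp [hkp, hkq, h', -Equiv.Perm.coe_inv]
  have B (y k : G) (j : Fin m) : mulSingle j (y⁻¹ * k * y * k⁻¹) ∈ K := by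
    obtain ⟨i, hij⟩ : ∃ i, i ≠ j := by
      by_cases hj : p = j
      · exact ⟨_, hj ▸ hp⟩
      · exact ⟨_, hj⟩
    have hE := A y⁻¹ hij
    rw [inv_inv] at hE
    have := K.mul_mem (K.inv_mem hE) (Subgroup.Normal.conj_mem ‹K.Normal› _ hE (mulSingle j k))
    convert this using 1
    ext k
    by_cases hkj : k = j
    · subst hkj
      simp [hij.symm, mul_assoc]
    · by_cases hki : k = i
      · subst hki
        simp [hij, mul_assoc]
      · simp [hkj, hki]
  have := K.mul_mem (A (c⁻¹ * x * c) hij) (B c x j)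
  convert this using 1
  ext k
  by_cases hkj : k = j
  · subst hkj
    simp [hij.symm, mul_assoc]
  · by_cases hki : k = i
    · subst hki
      simp [hij, mul_assoc]
    · simp [hkj, hki]

/-- Labels can be moved to one coordinate inside a normal subgroup that is not made of labels. -/
theorem exists_mulSingle_mem {w : WreathPerm G m} (hw : w ∈ N) (h1 : w.right ≠ 1)
    {v : WreathPerm G m} (hv : v ∈ N) (i : Fin m) :
    ∃ x, (⟨mulSingle i x, v.right⟩ : WreathPerm G m) ∈ N := by
  obtain ⟨x, hx⟩ : ∃ x, v.left⁻¹ * Function.update (1 : Fin m → G) i x ∈ N.comap inl := by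
    refine exists_inv_mul_update_mem _ _ _ fun j hj => ⟨v.left j, ?_⟩
    simpa using mulSingle_mul_mem_of_right_ne_one hw h1 hj.symm (v.left j)
  refine ⟨x, ?_⟩
  have := N.mul_mem (Subgroup.Normal.conj_mem ‹N.Normal› _ hx (inl v.left)) hv
  convert this using 1
  ext k
  · simp [mulSingle]
  · simp

/-- If `N` moves points, its image in `S_m` contains `A_m`, as `m ≥ 5`. Then `N` contains a 3-cycle
with a single label, which `h3` puts into `N'`, so `N ⊓ N'` also maps onto at least `A_m`. An even
element of `N` thus differs from one of `N ⊓ N'` by labels alone; for odd elements `h2` supplies a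
transposition. -/
theorem WreathPerm.le_of_data (hm : 5 ≤ m) {a b c : Fin m} (hab : a ≠ b) (hbc : b ≠ c)
    (hac : a ≠ c) (hK : N.comap inl ≤ N'.comap inl)
    (h2 : ∀ x, (⟨mulSingle a x, Equiv.swap a b⟩ : WreathPerm G m) ∈ N →
      (⟨mulSingle a x, Equiv.swap a b⟩ : WreathPerm G m) ∈ N')
    (h3 : ∀ x, (⟨mulSingle a x, Equiv.swap a b * Equiv.swap a c⟩ : WreathPerm G m) ∈ N →
      (⟨mulSingle a x, Equiv.swap a b * Equiv.swap a c⟩ : WreathPerm G m) ∈ N') : N ≤ N' := by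
  have hcard : 5 ≤ Nat.card (Fin m) := by simpa
  have hsurj : Function.Surjective
      (SemidirectProduct.rightHom : WreathPerm G m →* Equiv.Perm (Fin m)) :=
    SemidirectProduct.rightHom_surjective
  have alt {M : Subgroup (WreathPerm G m)} (hM : M.Normal) {w : WreathPerm G m} (hw : w ∈ M)
      (h1 : w.right ≠ 1) : alternatingGroup (Fin m) ≤ M.map SemidirectProduct.rightHom := by
    have : (M.map SemidirectProduct.rightHom).Normal := Subgroup.Normal.map hM _ hsurj
    apply Equiv.Perm.alternatingGroup_le_of_normal hcard
    exact (Subgroup.nontrivial_iff_exists_ne_one _).2 ⟨w.right, ⟨w, hw, rfl⟩, h1⟩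
  have label {w : WreathPerm G m} (hw : w ∈ N) (h1 : w.right = 1) : w ∈ N' := by
    have : w = inl w.left := by
      ext k
      · simp
      · simp [h1]
    rw [this] at hw ⊢
    exact hK hw
  intro w hw
  by_cases h1 : w.right = 1
  · exact label hw h1
  have hN := alt ‹_› hw h1
  let τ : Equiv.Perm (Fin m) := Equiv.swap a b * Equiv.swap a c
  have hτ : τ.IsThreeCycle := Equiv.Perm.isThreeCycle_swap_mul_swap_same hab hac hbc
  obtain ⟨v, hv, hvτ⟩ := hN hτ.mem_alternatingGroup
  obtain ⟨x, hx⟩ := exists_mulSingle_mem hw h1 hv a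
  have hvτ' : v.right = τ := hvτ
  rw [hvτ'] at hx
  have hQ : alternatingGroup (Fin m) ≤ (N ⊓ N').map SemidirectProduct.rightHom :=
    alt inferInstance (w := ⟨mulSingle a x, τ⟩) ⟨hx, h3 x hx⟩ (fun h => by
      have := hτ.orderOf
      change τ = 1 at h
      simp [h] at this)
  suffices H : w.right ∈ (N ⊓ N').map SemidirectProduct.rightHom by
    obtain ⟨u, hu, huw⟩ := H
    have huw' : u.right = w.right := huw
    have := label (N.mul_mem hw (N.inv_mem hu.1)) (by simp [huw'])
    simpa using N'.mul_mem this hu.2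
  rcases Int.units_eq_one_or (Equiv.Perm.sign w.right) with hs | hs
  · exact hQ (Equiv.Perm.mem_alternatingGroup.2 hs)
  -- For odd `w.right` this permutation is even, so it lifts to `u` in `N`, and `u * w` lies over
  -- the transposition.
  obtain ⟨u, hu, huw⟩ := hN (x := Equiv.swap a b * w.right⁻¹)
    (Equiv.Perm.mem_alternatingGroup.2 (by simp [hs, Equiv.Perm.sign_swap hab]))
  have huw' : u.right = Equiv.swap a b * w.right⁻¹ := huw
  obtain ⟨y, hy⟩ := exists_mulSingle_mem hw h1 (N.mul_mem hu hw) a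
  have e : (u * w).right = Equiv.swap a b := by simp [huw']
  rw [e] at hy
  have hsw : Equiv.swap a b ∈ (N ⊓ N').map SemidirectProduct.rightHom :=
    ⟨_, ⟨hy, h2 y hy⟩, rfl⟩
  have hal := hQ (x := Equiv.swap a b * w.right)
    (Equiv.Perm.mem_alternatingGroup.2 (by simp [hs, Equiv.Perm.sign_swap hab]))
  simpa using Subgroup.mul_mem _ hsw hal

end WreathSubgroups

/-! ### Chains of normal subgroups -/

section ChiefLength

variable {G : Type*} [Group G]

theorem ncard_le_chiefLength [Finite G] {C : Set {N : Subgroup G // N.Normal}}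
    (hC : IsChain (· ≤ ·) C) : C.ncard ≤ chiefLength G := by
  obtain ⟨M, hM, hCM⟩ := hC.exists_maxChain
  refine (Set.ncard_le_ncard hCM (Set.toFinite M)).trans (le_csSup ?_ ⟨M, hM, rfl⟩)
  refine ⟨Nat.card {N : Subgroup G // N.Normal}, ?_⟩
  rintro _ ⟨C, -, rfl⟩
  exact Set.ncard_le_card C

theorem one_le_chiefLength [Finite G] : 1 ≤ chiefLength G := by
  have := ncard_le_chiefLength (G := G) (C := {⟨⊥, inferInstance⟩}) (by simp)
  simpa using this

theorem exists_chain_ncard_eq [Finite G] :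
    ∃ C : Set {N : Subgroup G // N.Normal}, IsChain (· ≤ ·) C ∧ C.ncard = chiefLength G := by
  obtain ⟨M, hM, -⟩ := (IsChain.empty : IsChain (α := {N : Subgroup G // N.Normal}) (· ≤ ·) ∅).exists_maxChain
  obtain ⟨C, hC, h⟩ : chiefLength G ∈ {k : ℕ | ∃ C : Set {N : Subgroup G // N.Normal},
      IsChiefSeries C ∧ C.ncard = k} := by
    refine Nat.sSup_mem ⟨M.ncard, M, hM, rfl⟩ ?_
    refine ⟨Nat.card {N : Subgroup G // N.Normal}, ?_⟩
    rintro _ ⟨C, -, rfl⟩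
    exact Set.ncard_le_card C
  exact ⟨C, hC.isChain, h⟩

variable (G) in
-- Height in the poset of normal subgroups takes values below `c`; therefore a decreasing sequence
-- drops at most `c - 1` times.
theorem exists_height_lt_chiefLength [Finite G] :
    ∃ ht : {N : Subgroup G // N.Normal} → ℕ, StrictMono ht ∧ ∀ N, ht N < chiefLength G := by
  have hle (N : {N : Subgroup G // N.Normal}) :
      Order.height N ≤ ((chiefLength G - 1 : ℕ) : ℕ∞) := by
    refine Order.height_le fun p _ => ?_
    have hc : IsChain (· ≤ ·) (Set.range p) := p.strictMono.monotone.isChain_range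
    have := ncard_le_chiefLength hc
    rw [← Nat.card_coe_set_eq, Nat.card_range_of_injective p.strictMono.injective, Nat.card_fin] at this
    exact_mod_cast Nat.le_sub_one_of_lt this
  have hfin (N : {N : Subgroup G // N.Normal}) : Order.height N ≠ ⊤ :=
    ne_top_of_le_ne_top (ENat.natCast_ne_top _) (hle N)
  refine ⟨fun N => (Order.height N).toNat, fun N M h => ?_, fun N => ?_⟩
  · have := Order.height_strictMono h (lt_top_iff_ne_top.2 (hfin N))
    rw [← ENat.natCast_toNat (hfin N), ← ENat.natCast_toNat (hfin M)] at this
    exact_mod_cast this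
  · have := hle N
    rw [← ENat.natCast_toNat (hfin N)] at this
    have h2 : (Order.height N).toNat ≤ chiefLength G - 1 := by exact_mod_cast this
    have := one_le_chiefLength (G := G)
    dsimp only
    omega

end ChiefLength

/-! ### Recording the drops of a decreasing sequence -/

section Drops

/-- The first positive position, at most `n + 1`, where a sequence is at most `j`. -/
noncomputable def firstDrop (b : ℕ → ℕ) (n j : ℕ) : ℕ := sInf {m | 1 ≤ m ∧ (b m ≤ j ∨ n < m)}

theorem firstDrop_le (b : ℕ → ℕ) (n j : ℕ) : firstDrop b n j ≤ n + 1 :=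
  Nat.sInf_le ⟨by omega, Or.inr (by omega)⟩

/-- Earlier terms exceed the new value, so each drop is recovered from the level that it reaches.
Drops can thus be indexed by levels. -/
theorem firstDrop_eq {b : ℕ → ℕ} {n m : ℕ} (hb : ∀ k, 1 ≤ k → k + 1 ≤ n → b (k + 1) ≤ b k)
    (hm : 1 ≤ m) (hmn : m + 1 ≤ n) (h : b (m + 1) < b m) : firstDrop b n (b (m + 1)) = m + 1 := by
  have anti : ∀ k, 1 ≤ k → ∀ l, k ≤ l → l ≤ n → b l ≤ b k := by
    intro k hk l hkl
    induction l, hkl using Nat.le_induction with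
    | base => exact fun _ => le_rfl
    | succ l hl ih => exact fun h => (hb l (hk.trans hl) h).trans (ih (by omega))
  apply le_antisymm
  · exact Nat.sInf_le ⟨by omega, Or.inl le_rfl⟩
  · refine le_csInf (Set.nonempty_of_mem (x := n + 1) ⟨by omega, Or.inr (by omega)⟩) ?_
    rintro k ⟨hk1, hk | hk⟩
    · by_contra hlt
      have := anti k hk1 m (by omega) (by omega)
      omega
    · omega

/-- Two decreasing sequences with the same positions of drops and the same data there. -/
theorem eq_or_const_of_firstDrop_eq {X Z : Type*} [PartialOrder X] {ht : X → ℕ} (hht : StrictMono ht)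
    {c n : ℕ} (hc : ∀ x, ht x < c) {a a' : ℕ → X} {z z' : ℕ → Z}
    (ha : ∀ k, 1 ≤ k → k + 1 ≤ n → a (k + 1) ≤ a k)
    (ha' : ∀ k, 1 ≤ k → k + 1 ≤ n → a' (k + 1) ≤ a' k)
    (hd : ∀ j < c - 1, firstDrop (ht ∘ a) n j = firstDrop (ht ∘ a') n j)
    (hz : ∀ j < c - 1, z (firstDrop (ht ∘ a) n j) = z' (firstDrop (ht ∘ a') n j))
    {m : ℕ} (hm : 1 ≤ m) (hmn : m + 1 ≤ n) :
    z (m + 1) = z' (m + 1) ∨ (a (m + 1) = a m ∧ a' (m + 1) = a' m) := by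
  have key {a : ℕ → X} (ha : ∀ k, 1 ≤ k → k + 1 ≤ n → a (k + 1) ≤ a k) :
      (∃ j < c - 1, firstDrop (ht ∘ a) n j = m + 1) ∨ a (m + 1) = a m := by
    rcases (ha m hm hmn).lt_or_eq with h | h
    · have h' := hht h
      -- The level reached is below `ht (a m) < c`, hence below `c - 1`.
      refine Or.inl ⟨ht (a (m + 1)), by have := hc (a m); omega, ?_⟩
      exact firstDrop_eq (b := ht ∘ a) (fun k h1 h2 => hht.monotone (ha k h1 h2)) hm hmn h'
    · exact Or.inr h
  rcases key ha with ⟨j, hj, h⟩ | h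
  · have := hz j hj
    rw [← hd j hj, h] at this
    exact Or.inl this
  rcases key ha' with ⟨j, hj, h'⟩ | h'
  · have := hz j hj
    rw [hd j hj, h'] at this
    exact Or.inl this
  exact Or.inr ⟨h, h'⟩

end Drops

/-! ### Bounded data for the labels and permutations of one rank -/

section LabelData

open Pi (mulSingle)

open SemidirectProduct (inl)

variable {G : Type*} [Group G] {m : ℕ}

/-- Data that determine a permutation invariant subgroup of `G ^ m`. -/
def labelData (K : Subgroup (Fin m → G)) : Set G × Set (G × G) :=
  ({d | ∀ i j : Fin m, i.val = 0 → j.val = 1 → mulSingle i d * mulSingle j d⁻¹ ∈ K},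
    {p | ∀ i : Fin m, i.val = 0 → Function.update (fun _ => p.2) i p.1 ∈ K})

/-- The type of `labelData` does not involve `m`, so the number of possible `K` is bounded uniformly
in the rank. -/
theorem le_of_labelData_eq {K K' : Subgroup (Fin m → G)} (hm : 1 ≤ m) (hK : PermInvariant K)
    (hK' : PermInvariant K') (h : labelData K = labelData K') : K ≤ K' := by
  have h1 := congrArg Prod.fst h
  have h2 := congrArg Prod.snd h
  refine hK.le_of_data hK' ⟨0, hm⟩ (fun j hj => ?_) (fun x z hx => ?_)
  · have hm2 : 1 < m := by
      have := j.isLt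
      have : j.val ≠ 0 := fun h => hj (Fin.ext h)
      omega
    refine ⟨⟨1, hm2⟩, by simp [Fin.ext_iff], fun d hd => ?_⟩
    have : d ∈ (labelData K).1 := by
      intro i j hi hj
      rwa [show i = ⟨0, hm⟩ from Fin.ext hi, show j = ⟨1, hm2⟩ from Fin.ext hj]
    rw [h1] at this
    exact this _ _ rfl rfl
  · have : (x, z) ∈ (labelData K).2 := by
      intro i hi
      rwa [show i = ⟨0, hm⟩ from Fin.ext hi]
    rw [h2] at this
    exact this _ rfl

/-- Data that determine a normal subgroup of `G ≀ S_m` with given labels, for `m ≥ 5`. -/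
def permData (N : Subgroup (WreathPerm G m)) : Set G × Set G :=
  ({x | ∀ a b : Fin m, a.val = 0 → b.val = 1 → (⟨mulSingle a x, Equiv.swap a b⟩ : WreathPerm G m) ∈ N},
    {x | ∀ a b c : Fin m, a.val = 0 → b.val = 1 → c.val = 2 →
      (⟨mulSingle a x, Equiv.swap a b * Equiv.swap a c⟩ : WreathPerm G m) ∈ N})

theorem le_of_permData_eq {N N' : Subgroup (WreathPerm G m)} [N.Normal] [N'.Normal] (hm : 5 ≤ m)
    (hK : N.comap inl ≤ N'.comap inl) (h : permData N = permData N') : N ≤ N' := by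
  have h1 := congrArg Prod.fst h
  have h2 := congrArg Prod.snd h
  refine WreathPerm.le_of_data hm (a := ⟨0, by omega⟩) (b := ⟨1, by omega⟩) (c := ⟨2, by omega⟩)
    (by simp [Fin.ext_iff]) (by simp [Fin.ext_iff]) (by simp [Fin.ext_iff]) hK ?_ ?_
  · intro x hx
    have : x ∈ (permData N).1 := by
      intro a b ha hb
      have ha' : a = ⟨0, by omega⟩ := Fin.ext ha
      have hb' : b = ⟨1, by omega⟩ := Fin.ext hb
      rwa [ha', hb']
    rw [h1] at this
    exact this _ _ rfl rfl
  · intro x hx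
    have : x ∈ (permData N).2 := by
      intro a b c ha hb hc
      have ha' : a = ⟨0, by omega⟩ := Fin.ext ha
      have hb' : b = ⟨1, by omega⟩ := Fin.ext hb
      have hc' : c = ⟨2, by omega⟩ := Fin.ext hc
      rwa [ha', hb', hc']
    rw [h2] at this
    exact this _ _ _ rfl rfl rfl

variable {K : Subgroup (Fin (m + 1) → G)} {H : Subgroup (Fin m → G)}

theorem mulSingle_castSucc_comp (i : Fin m) (x : G) :
    (mulSingle i.castSucc x : Fin (m + 1) → G) ∘ Fin.castSucc = mulSingle i x := by
  ext k
  by_cases hk : k = i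
  · subst hk
    simp
  · have : k.castSucc ≠ i.castSucc := fun h => hk (Fin.castSucc_injective m h)
    simp [hk, this]

theorem mulSingle_last_comp (x : G) :
    (mulSingle (Fin.last m) x : Fin (m + 1) → G) ∘ Fin.castSucc = 1 := by
  ext k
  simp [(Fin.castSucc_lt_last k).ne]

theorem singleSubgroup_le_of_restrict (hm : 1 ≤ m) (hK : PermInvariant K) (hH : PermInvariant H)
    (h : ∀ g ∈ K, g ∘ Fin.castSucc ∈ H) : singleSubgroup K ≤ singleSubgroup H := by
  intro x hx
  rw [hK.mem_singleSubgroup (Fin.castSucc ⟨0, hm⟩)] at hx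
  rw [hH.mem_singleSubgroup ⟨0, hm⟩]
  rw [← mulSingle_castSucc_comp]
  exact h _ hx

theorem entrySubgroup_le_of_restrict (hm : 1 ≤ m) (hK : PermInvariant K) (hH : PermInvariant H)
    (h : ∀ g ∈ K, g ∘ Fin.castSucc ∈ H) : entrySubgroup K ≤ entrySubgroup H := by
  intro x hx
  rw [hK.mem_entrySubgroup (Fin.castSucc ⟨0, hm⟩)] at hx
  rw [hH.mem_entrySubgroup ⟨0, hm⟩]
  obtain ⟨g, hg, rfl⟩ := hx
  exact ⟨_, h g hg, rfl⟩

/-- For `g ∈ K`, the two-point element built from a quotient of entries can be moved so that one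
point is last. Restriction forgets that point and leaves a single label of `H`, hence of `K` by
`hL`. Conversely, `g` is compared with a member of `K` having the same entry at `0`. -/
theorem mem_iff_of_singleSubgroup_eq (hm : 1 ≤ m) (hK : PermInvariant K) (hH : PermInvariant H)
    (h : ∀ g ∈ K, g ∘ Fin.castSucc ∈ H) (hL : singleSubgroup K = singleSubgroup H)
    (g : Fin (m + 1) → G) :
    g ∈ K ↔ (∀ i j, (g i)⁻¹ * g j ∈ singleSubgroup K) ∧ ∀ i, g i ∈ entrySubgroup K := by
  have hdiff (g) (hg : g ∈ K) (i j) : (g i)⁻¹ * g j ∈ singleSubgroup K := by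
    by_cases hij : i = j
    · subst hij
      simp [one_mem]
    have h1 := hK.mulSingle_mul_mem_of_ne (i' := Fin.castSucc ⟨0, hm⟩) (j' := Fin.last m) hij
      (Fin.castSucc_lt_last _).ne (hK.mulSingle_mul_mem hg hij)
    rw [hL, hH.mem_singleSubgroup ⟨0, hm⟩]
    have h2 := h _ h1
    rwa [Pi.mul_comp, mulSingle_castSucc_comp, mulSingle_last_comp, mul_one] at h2
  refine ⟨fun hg => ⟨hdiff g hg, fun i => (hK.mem_entrySubgroup i).2 ⟨g, hg, rfl⟩⟩, ?_⟩
  rintro ⟨h1, h2⟩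
  obtain ⟨g', hg', h0⟩ := (hK.mem_entrySubgroup 0).1 (h2 0)
  have : g'⁻¹ * g ∈ K := by
    refine hK.mem_of_forall_mem_singleSubgroup fun i => ?_
    have := mul_mem (hdiff g' hg' i 0) (h1 0 i)
    rw [h0] at this
    simpa [mul_assoc] using this
  simpa using K.mul_mem hg' this

end LabelData

/-! ### Codes of congruences and the upper bound -/

namespace PartialWreath

variable {G : Type*} [Group G] {n : ℕ} (σ τ : Con (PartialWreath G n))

theorem permInvariant_baseSubgroup (m : ℕ) : PermInvariant (baseSubgroup σ m) :=
  permInvariant_comap_inl _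

instance (m : ℕ) : (baseSubgroup σ m).Normal :=
  inferInstanceAs ((localSubgroup σ m).comap SemidirectProduct.inl).Normal

/-- The single labels of rank `m`. -/
noncomputable def single (m : ℕ) : {N : Subgroup G // N.Normal} :=
  ⟨singleSubgroup (baseSubgroup σ m), inferInstance⟩

/-- The entries of labels of rank `m`. -/
noncomputable def entry (m : ℕ) : {N : Subgroup G // N.Normal} :=
  ⟨entrySubgroup (baseSubgroup σ m), inferInstance⟩

theorem single_succ_le {m : ℕ} (hm : 1 ≤ m) (hmn : m + 1 ≤ n) : single σ (m + 1) ≤ single σ m :=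
  singleSubgroup_le_of_restrict hm (permInvariant_baseSubgroup σ _)
    (permInvariant_baseSubgroup σ _) fun _ hg => restrict_mem_baseSubgroup hmn hg

theorem entry_succ_le {m : ℕ} (hm : 1 ≤ m) (hmn : m + 1 ≤ n) : entry σ (m + 1) ≤ entry σ m :=
  entrySubgroup_le_of_restrict hm (permInvariant_baseSubgroup σ _)
    (permInvariant_baseSubgroup σ _) fun _ hg => restrict_mem_baseSubgroup hmn hg

/-- The finite set of codes of congruences on `G ≀ I_n`. -/
abbrev ConCode (G : Type*) [Group G] (c n : ℕ) :=
  (Fin (n + 1) × (Set G × Set G) × (∀ m : Fin 5, Subgroup (WreathPerm G m)) ×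
    (Set G × Set (G × G))) ×
  (Fin (c - 1) → Fin (n + 2) × (Set G × Set (G × G))) ×
  (Fin (c - 1) → Fin (n + 2) × (Set G × Set (G × G)))

variable (ht : {N : Subgroup G // N.Normal} → ℕ) (c : ℕ)

/-- The data of rank `m`. -/
noncomputable def rankData (m : ℕ) : Set G × Set (G × G) := labelData (baseSubgroup σ m)

/-- The positions and data of the drops of a sequence of normal subgroups. -/
noncomputable def dropCode (a : ℕ → {N : Subgroup G // N.Normal}) :
    Fin (c - 1) → Fin (n + 2) × (Set G × Set (G × G)) :=
  fun j => (⟨firstDrop (ht ∘ a) n j, Nat.lt_succ_of_le (firstDrop_le _ _ _)⟩,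
    rankData σ (firstDrop (ht ∘ a) n j))

/-- The code of a congruence. -/
noncomputable def conCode : ConCode G c n :=
  ((⟨nullRank σ, Nat.lt_succ_of_le nullRank_le⟩, permData (localSubgroup σ (nullRank σ + 1)),
    fun m => localSubgroup σ m, rankData σ 1),
    dropCode σ ht c (single σ), dropCode σ ht c (entry σ))

variable {σ τ ht c}

theorem eq_or_const_of_dropCode_eq (hht : StrictMono ht) (hc : ∀ N, ht N < c)
    {a a' : ℕ → {N : Subgroup G // N.Normal}}
    (ha : ∀ k, 1 ≤ k → k + 1 ≤ n → a (k + 1) ≤ a k)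
    (ha' : ∀ k, 1 ≤ k → k + 1 ≤ n → a' (k + 1) ≤ a' k)
    (h : dropCode σ ht c a = dropCode τ ht c a') {m : ℕ} (hm : 1 ≤ m) (hmn : m + 1 ≤ n) :
    rankData σ (m + 1) = rankData τ (m + 1) ∨ (a (m + 1) = a m ∧ a' (m + 1) = a' m) := by
  refine eq_or_const_of_firstDrop_eq hht hc ha ha' (fun j hj => ?_) (fun j hj => ?_) hm hmn
  · exact congrArg (fun p => p.1.val) (congrFun h ⟨j, hj⟩)
  · exact congrArg Prod.snd (congrFun h ⟨j, hj⟩)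

theorem baseSubgroup_eq_of_rankData_eq {m : ℕ} (hm : 1 ≤ m) (h : rankData σ m = rankData τ m) :
    baseSubgroup σ m = baseSubgroup τ m :=
  le_antisymm
    (le_of_labelData_eq hm (permInvariant_baseSubgroup σ m) (permInvariant_baseSubgroup τ m) h)
    (le_of_labelData_eq hm (permInvariant_baseSubgroup τ m) (permInvariant_baseSubgroup σ m) h.symm)

/-- By induction on the rank: rank 1 and every rank where a sequence drops are recorded in the code,
and elsewhere the preceding rank determines the labels. -/
theorem baseSubgroup_eq_of_conCode_eq (hht : StrictMono ht) (hc : ∀ N, ht N < c)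
    (h : conCode σ ht c = conCode τ ht c) {m : ℕ} (hm : 1 ≤ m) :
    m ≤ n → baseSubgroup σ m = baseSubgroup τ m := by
  induction m, hm using Nat.le_induction with
  | base =>
    intro _
    exact baseSubgroup_eq_of_rankData_eq le_rfl (congrArg (fun p => p.1.2.2.2) h)
  | succ m hm ih =>
    intro hmn
    have ih := ih (by omega)
    rcases eq_or_const_of_dropCode_eq hht hc (fun _ => single_succ_le σ) (fun _ => single_succ_le τ)
      (congrArg (fun p => p.2.1) h) hm hmn with h1 | ⟨h1, h1'⟩
    · exact baseSubgroup_eq_of_rankData_eq (by omega) h1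
    rcases eq_or_const_of_dropCode_eq hht hc (fun _ => entry_succ_le σ) (fun _ => entry_succ_le τ)
      (congrArg (fun p => p.2.2) h) hm hmn with h2 | ⟨h2, h2'⟩
    · exact baseSubgroup_eq_of_rankData_eq (by omega) h2
    replace h1 := congrArg Subtype.val h1
    replace h1' := congrArg Subtype.val h1'
    replace h2 := congrArg Subtype.val h2
    replace h2' := congrArg Subtype.val h2'
    simp only [single] at h1 h1'
    simp only [entry] at h2 h2'
    ext g
    rw [mem_iff_of_singleSubgroup_eq hm (permInvariant_baseSubgroup σ _)
        (permInvariant_baseSubgroup σ _) (fun _ hg => restrict_mem_baseSubgroup hmn hg) h1,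
      mem_iff_of_singleSubgroup_eq hm (permInvariant_baseSubgroup τ _)
        (permInvariant_baseSubgroup τ _) (fun _ hg => restrict_mem_baseSubgroup hmn hg) h1',
      h1, h1', h2, h2', ih]

theorem le_of_conCode_eq (hht : StrictMono ht) (hc : ∀ N, ht N < c)
    (h : conCode σ ht c = conCode τ ht c) : σ ≤ τ := by
  have ht' : nullRank σ = nullRank τ := congrArg (fun p => p.1.1.val) h
  refine le_of_localSubgroup_le ht' fun m hm => ?_
  by_cases hmn : m ≤ n
  swap
  -- Beyond `n` there are no embeddings, so membership in the local subgroup is vacuous.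
  · exact fun w _ e => absurd (by simpa using Fintype.card_le_of_embedding e) hmn
  have hb := baseSubgroup_eq_of_conCode_eq hht hc h (by omega) hmn
  by_cases hm1 : nullRank σ + 1 = m
  · by_cases hm5 : m < 5
    · exact (congrFun (congrArg (fun p => p.1.2.2.1) h) ⟨m, hm5⟩).le
    · have hp : permData (localSubgroup σ (nullRank σ + 1))
          = permData (localSubgroup τ (nullRank τ + 1)) := congrArg (fun p => p.1.2.1) h
      rw [← ht', hm1] at hp
      exact le_of_permData_eq (by omega) hb.le hp
  · intro w hw
    have h1 := right_eq_one_of_mem_localSubgroup hmn (by omega) hw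
    have : w = SemidirectProduct.inl w.left := by
      ext k
      · simp
      · simp [h1]
    rw [this] at hw ⊢
    exact hb.le hw

theorem conCode_injective (hht : StrictMono ht) (hc : ∀ N, ht N < c) :
    Function.Injective fun σ : Con (PartialWreath G n) => conCode σ ht c :=
  fun _ _ h => le_antisymm (le_of_conCode_eq hht hc h) (le_of_conCode_eq hht hc h.symm)

instance [Finite G] : Finite (WreathPerm G n) :=
  Finite.of_equiv _ SemidirectProduct.equivProd.symm

/-- Needed for the lower bound, since `Nat.card` of an infinite type is `0`. -/
instance [Finite G] : Finite (Con (PartialWreath G n)) := by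
  obtain ⟨ht, hht, hc⟩ := exists_height_lt_chiefLength G
  exact Finite.of_injective _ (conCode_injective hht hc)

variable (G) in
theorem exists_card_con_le [Finite G] : ∃ B : ℕ, 0 < B ∧ ∀ n : ℕ, 1 ≤ n →
    Nat.card (Con (PartialWreath G n)) ≤ B * n ^ (2 * chiefLength G - 1) := by
  obtain ⟨ht, hht, hc⟩ := exists_height_lt_chiefLength G
  have h1 := one_le_chiefLength (G := G)
  set c := chiefLength G
  obtain ⟨p, hp⟩ : ∃ p, p = Nat.card (Set G × Set G) * (Nat.card (∀ m : Fin 5, Subgroup (WreathPerm G m)) *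
    Nat.card (Set G × Set (G × G))) := ⟨_, rfl⟩
  obtain ⟨q, hq⟩ : ∃ q, q = Nat.card (Set G × Set (G × G)) := ⟨_, rfl⟩
  have hp0 : 0 < p := by
    rw [hp]
    exact Nat.mul_pos Nat.card_pos (Nat.mul_pos Nat.card_pos Nat.card_pos)
  have hq0 : 0 < q := hq ▸ Nat.card_pos
  -- `p` counts the data recorded once, `q` the data per drop, and `3` comes from `n + 2 ≤ 3 * n`.
  refine ⟨p * (q ^ (c - 1)) ^ 2 * 3 ^ (2 * c - 1), by positivity, fun n hn => ?_⟩
  calc Nat.card (Con (PartialWreath G n)) ≤ Nat.card (ConCode G c n) :=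
        Nat.card_le_card_of_injective _ (conCode_injective hht hc)
    _ = (n + 1) * p * (((n + 2) * q) ^ (c - 1) * ((n + 2) * q) ^ (c - 1)) := by
        simp only [ConCode, Nat.card_prod, Nat.card_fun, Nat.card_fin, hp, hq]
    _ ≤ (n + 2) * p * (((n + 2) * q) ^ (c - 1) * ((n + 2) * q) ^ (c - 1)) := by gcongr; omega
    _ = p * (q ^ (c - 1)) ^ 2 * (n + 2) ^ (2 * c - 1) := by
        have : 2 * c - 1 = (c - 1) + (c - 1) + 1 := by omega
        rw [this, pow_succ, pow_add, mul_pow]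
        ring
    _ ≤ p * (q ^ (c - 1)) ^ 2 * (3 * n) ^ (2 * c - 1) := by gcongr; omega
    _ = _ := by rw [mul_pow]; ring

end PartialWreath

/-! ### Congruences from chains and the lower bound -/

namespace PartialWreath

variable {G : Type*} [Group G] {n : ℕ}

theorem rank_eq_of_map_eq {x y : PartialWreath G n} (h : x.map = y.map) : x.rank = y.rank := by
  simp only [rank, dom, h]

/-- The congruence that identifies all elements of rank in a lower set with each other, and labels
modulo a decreasing family of normal subgroups in the other ranks. -/
def chainCon (P : ℕ → Prop) (hP : ∀ k l, k ≤ l → P l → P k) (L : ℕ → Subgroup G) (hL : Antitone L)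
    [∀ k, (L k).Normal] : Con (PartialWreath G n) where
  r x y := (P x.rank ∧ P y.rank) ∨
    (x.map = y.map ∧ ∀ i, ∃ u ∈ L x.rank, y.label i = x.label i * (u : WithZero G))
  iseqv := by
    refine ⟨fun x => Or.inr ⟨rfl, fun i => ⟨1, one_mem _, by simp⟩⟩, ?_, ?_⟩
    · rintro x y (⟨h1, h2⟩ | ⟨h1, h2⟩)
      · exact Or.inl ⟨h2, h1⟩
      · refine Or.inr ⟨h1.symm, fun i => ?_⟩
        obtain ⟨u, hu, h⟩ := h2 i
        refine ⟨u⁻¹, inv_mem (rank_eq_of_map_eq h1 ▸ hu), ?_⟩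
        rw [h, mul_assoc, ← WithZero.coe_mul]
        simp
    · rintro x y z (⟨h1, h2⟩ | ⟨h1, h2⟩) (⟨h3, h4⟩ | ⟨h3, h4⟩)
      · exact Or.inl ⟨h1, h4⟩
      · exact Or.inl ⟨h1, rank_eq_of_map_eq h3 ▸ h2⟩
      · exact Or.inl ⟨rank_eq_of_map_eq h1 ▸ h3, h4⟩
      · refine Or.inr ⟨h1.trans h3, fun i => ?_⟩
        obtain ⟨u, hu, hxy⟩ := h2 i
        obtain ⟨v, hv, hyz⟩ := h4 i
        refine ⟨u * v, mul_mem hu (rank_eq_of_map_eq h1 ▸ hv), ?_⟩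
        rw [hyz, hxy, mul_assoc, WithZero.coe_mul]
  mul' := by
    rintro x x' y y' (⟨h1, h2⟩ | ⟨h1, h2⟩) (⟨h3, h4⟩ | ⟨h3, h4⟩)
    · exact Or.inl ⟨hP _ _ (rank_mul_le_left _ _) h1, hP _ _ (rank_mul_le_left _ _) h2⟩
    · exact Or.inl ⟨hP _ _ (rank_mul_le_left _ _) h1, hP _ _ (rank_mul_le_left _ _) h2⟩
    · exact Or.inl ⟨hP _ _ (rank_mul_le_right _ _) h3, hP _ _ (rank_mul_le_right _ _) h4⟩
    · refine Or.inr ⟨by rw [mul_map, mul_map, h1, h3], fun i => ?_⟩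
      cases hi : x.map i with
      | none => exact ⟨1, one_mem _, by simp [pull, ← h1, hi]⟩
      | some j =>
        obtain ⟨u, hu, hu'⟩ := h2 i
        obtain ⟨v, hv, hv'⟩ := h4 j
        by_cases hj : y.label j = 0
        · exact ⟨1, one_mem _, by simp [pull, ← h1, hi, hv', hj]⟩
        obtain ⟨k, hk⟩ := WithZero.ne_zero_iff_exists.1 hj
        -- Moving `u` past the label `k` of `y` conjugates it: `u k v = k (k⁻¹ u k) v`. The rank of
        -- a product is at most that of its factors, so `hL` applies.
        refine ⟨k⁻¹ * u * k * v, mul_mem ?_ (hL (rank_mul_le_right x y) hv), ?_⟩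
        · have := Subgroup.Normal.conj_mem inferInstance u (hL (rank_mul_le_left x y) hu) k⁻¹
          rwa [inv_inv] at this
        · simp only [mul_label, pull, ← h1, hi, Option.elim_some, hu', hv', ← hk]
          simp only [mul_assoc, ← WithZero.coe_mul, mul_inv_cancel_left]

/-- An increasing family of normal subgroups, continued by the whole group. -/
def extendTop {c : ℕ} (N : Fin c → {N : Subgroup G // N.Normal}) (k : ℕ) : Subgroup G :=
  if h : k < c then (N ⟨k, h⟩).1 else ⊤

instance {c : ℕ} (N : Fin c → {N : Subgroup G // N.Normal}) (k : ℕ) : (extendTop N k).Normal := by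
  unfold extendTop
  split_ifs with h
  · exact (N ⟨k, h⟩).2
  · infer_instance

theorem extendTop_mono {c : ℕ} {N : Fin c → {N : Subgroup G // N.Normal}} (hN : StrictMono N) :
    Monotone (extendTop N) := by
  intro k l hkl
  unfold extendTop
  split_ifs with h1 h2
  · exact hN.monotone (show (⟨k, h1⟩ : Fin c) ≤ ⟨l, h2⟩ from hkl)
  · exact le_top
  · omega
  · exact le_rfl

/-- The congruence given by a decreasing sequence of indices of terms of a chain of normal
subgroups, where the index after the last term stands for the collapsed ranks. -/
def indexCon {c : ℕ} {N : Fin c → {N : Subgroup G // N.Normal}} (hN : StrictMono N) {f : ℕ → ℕ}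
    (hf : Antitone f) : Con (PartialWreath G n) :=
  chainCon (fun m => c ≤ f m) (fun _ _ h1 h2 => h2.trans (hf h1)) (fun m => extendTop N (f m))
    ((extendTop_mono hN).comp_antitone hf)

/-- If `f m < f' m`, a partial identity of rank `m` separates the congruences: for `f' m < c` by a
label in the larger normal subgroup only, for `f' m = c` by its collapse to zero. -/
theorem le_of_indexCon_le {c : ℕ} {N : Fin c → {N : Subgroup G // N.Normal}} (hN : StrictMono N)
    {f f' : ℕ → ℕ} (hf : Antitone f) (hf' : Antitone f') (hc : ∀ m, f' m ≤ c)
    (h : (indexCon hN hf' : Con (PartialWreath G n)) ≤ indexCon hN hf) {m : ℕ} (hm : 1 ≤ m)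
    (hmn : m ≤ n) : f' m ≤ f m := by
  by_contra! hlt
  let e : Fin m ↪ Fin n := Fin.castLEEmb hmn
  let z : Fin m := ⟨0, hm⟩
  have hr (g : Fin m → G) : (ofEmb e g e).rank = m := rank_ofEmb e e g
  rcases (hc m).lt_or_eq with h1 | h1
  · obtain ⟨g, hg, hg'⟩ : ∃ g ∈ extendTop N (f' m), g ∉ extendTop N (f m) := by
      apply SetLike.exists_of_lt
      rw [extendTop, extendTop, dif_pos h1, dif_pos (hlt.trans h1)]
      exact hN (show (⟨f m, _⟩ : Fin c) < ⟨f' m, h1⟩ from hlt)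
    have h2 : (indexCon hN hf' : Con (PartialWreath G n)) (ofEmb e 1 e)
        (ofEmb e (Pi.mulSingle z g) e) := by
      refine Or.inr ⟨rfl, fun i => ?_⟩
      by_cases hi : i ∈ Set.range e
      · obtain ⟨a, rfl⟩ := hi
        refine ⟨Pi.mulSingle (M := fun _ => G) z g a, ?_, ?_⟩
        · rw [hr]
          by_cases ha : a = z
          · subst ha
            simpa using hg
          · simp [ha, one_mem]
        · rw [ofEmb_label_apply, ofEmb_label_apply]
          simp
      · refine ⟨1, one_mem _, ?_⟩
        rw [label_eq_zero (ofEmb_map_of_notMem _ _ _ hi),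
          label_eq_zero (ofEmb_map_of_notMem _ _ _ hi), zero_mul]
    rcases h h2 with ⟨h3, -⟩ | ⟨-, h3⟩
    · rw [hr] at h3
      omega
    · obtain ⟨u, hu, h4⟩ := h3 (e z)
      rw [hr] at hu
      rw [ofEmb_label_apply, ofEmb_label_apply] at h4
      simp only [Pi.mulSingle_eq_same, Pi.one_apply, WithZero.coe_one, one_mul,
        WithZero.coe_inj] at h4
      exact hg' (h4 ▸ hu)
  · have h2 : (indexCon hN hf' : Con (PartialWreath G n)) (ofEmb e 1 e) 0 :=
      Or.inl ⟨by rw [hr]; exact h1.ge, by rw [rank_zero]; exact h1.ge.trans (hf' (Nat.zero_le m))⟩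
    rcases h h2 with ⟨h3, -⟩ | ⟨h3, -⟩
    · rw [hr] at h3
      omega
    · have := rank_eq_of_map_eq h3
      rw [hr, rank_zero] at this
      omega

/-- The number of elements of a multiset that are at least `m - 1`. -/
def upperCount (s : Multiset (Fin n)) (m : ℕ) : ℕ := s.countP fun t => m ≤ t.val + 1

theorem antitone_upperCount (s : Multiset (Fin n)) : Antitone (upperCount s) := by
  intro k l hkl
  induction s using Multiset.induction_on with
  | empty => simp [upperCount]
  | cons a s ih =>
    simp only [upperCount, Multiset.countP_cons] at ih ⊢
    split_ifs <;> omega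

/-- Multiplicities are the drops of `upperCount`, which therefore determines the multiset. -/
theorem upperCount_eq (s : Multiset (Fin n)) (i : Fin n) :
    upperCount s (i + 1) = upperCount s (i + 2) + s.count i := by
  induction s using Multiset.induction_on with
  | empty => simp [upperCount]
  | cons a s ih =>
    simp only [upperCount, Multiset.countP_cons, Multiset.count_cons, Fin.ext_iff] at ih ⊢
    split_ifs <;> omega

theorem upperCount_eq_zero (s : Multiset (Fin n)) {m : ℕ} (hm : n < m) : upperCount s m = 0 := by
  rw [upperCount, Multiset.countP_eq_zero]
  intro a _
  omega

theorem eq_of_upperCount_eq {s s' : Multiset (Fin n)}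
    (h : ∀ m, 1 ≤ m → m ≤ n → upperCount s m = upperCount s' m) : s = s' := by
  have h' (m : ℕ) (hm : 1 ≤ m) : upperCount s m = upperCount s' m := by
    by_cases hmn : m ≤ n
    · exact h m hm hmn
    · rw [upperCount_eq_zero s (by omega), upperCount_eq_zero s' (by omega)]
  ext i
  have h1 := upperCount_eq s i
  have h2 := upperCount_eq s' i
  rw [h' _ (by omega), h' _ (by omega)] at h1
  omega

variable (G) in
theorem exists_strictMono_normal [Finite G] :
    ∃ N : Fin (chiefLength G) → {N : Subgroup G // N.Normal}, StrictMono N := by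
  classical
  obtain ⟨C, hC, hc⟩ := exists_chain_ncard_eq (G := G)
  let _ : LinearOrder C :=
    { (inferInstance : PartialOrder C) with
      le_total := fun a b => hC.total a.2 b.2
      toDecidableLE := Classical.decRel _ }
  let _ := Fintype.ofFinite C
  have hcard : Fintype.card C = chiefLength G := by
    rw [← hc, ← Nat.card_coe_set_eq, Nat.card_eq_fintype_card]
  exact ⟨fun k => (Fintype.orderIsoFinOfCardEq C hcard k).1,
    fun a b hab => (Fintype.orderIsoFinOfCardEq C hcard).strictMono hab⟩

/-- Multisets of size `c` give decreasing sequences bounded by `c` with value `c` at rank 1, so all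
the congruences used here collapse rank 1. -/
theorem card_sym_le_card_con [Finite G] :
    Nat.card (Sym (Fin n) (chiefLength G)) ≤ Nat.card (Con (PartialWreath G n)) := by
  obtain ⟨N, hN⟩ := exists_strictMono_normal G
  refine Nat.card_le_card_of_injective
    (fun s : Sym (Fin n) (chiefLength G) => indexCon hN (antitone_upperCount s.1)) ?_
  have hle (s : Sym (Fin n) (chiefLength G)) (m : ℕ) : upperCount s.1 m ≤ chiefLength G :=
    (Multiset.countP_le_card _ _).trans_eq s.2
  intro s s' h
  apply Subtype.ext
  apply eq_of_upperCount_eq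
  intro m hm hmn
  exact le_antisymm (le_of_indexCon_le hN _ _ (hle s) (le_of_eq h) hm hmn)
    (le_of_indexCon_le hN _ _ (hle s') (ge_of_eq h) hm hmn)

theorem pow_div_factorial_le_card_con [Finite G] (hn : 1 ≤ n) :
    (n : ℝ) ^ chiefLength G / (chiefLength G).factorial
      ≤ (Nat.card (Con (PartialWreath G n)) : ℝ) := by
  refine le_trans ?_ (Nat.cast_le.2 card_sym_le_card_con)
  rw [Nat.card_eq_fintype_card, Sym.card_sym_eq_multichoose, Fintype.card_fin, Nat.multichoose_eq]
  have h := Nat.pow_le_choose (α := ℝ) (chiefLength G) (n + chiefLength G - 1)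
  rwa [show n + chiefLength G - 1 + 1 - chiefLength G = n by omega] at h

end PartialWreath

theorem mainTheorem2 (G : Type*) [Group G] [Finite G] :
    ∃ A B : ℝ, 0 < A ∧ 0 < B ∧ ∀ n : ℕ, 1 ≤ n →
      A * (n : ℝ) ^ chiefLength G ≤ (Nat.card (Con (PartialWreath G n)) : ℝ) ∧
      (Nat.card (Con (PartialWreath G n)) : ℝ) ≤ B * (n : ℝ) ^ (2 * chiefLength G - 1) := by
  obtain ⟨B, hB, h⟩ := PartialWreath.exists_card_con_le G
  refine ⟨((chiefLength G).factorial : ℝ)⁻¹, B, by positivity, by exact_mod_cast hB,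
    fun n hn => ⟨?_, by exact_mod_cast h n hn⟩⟩
  rw [inv_mul_eq_div]
  exact PartialWreath.pow_div_factorial_le_card_con hn
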